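/- Let $n\ge k\ge 0$ be integers, let $\pi:\mathbb{R}^n\to\mathbb{R}^{n-k}$ be the projection onto the first $n-k$ coordinates and $p:\mathbb{R}^n\to\mathbb{R}^k$ the projection onto the last $k$ coordinates. **Mixed fiber polytopes.** For a polytope $\Delta\subset\mathbb{R}^n$ let $$F_p(\Delta):=\pi\left(\left\{\int_{p(\Delta)}s(x)\,dx \;:\; s:p(\Delta)\to\Delta \text{ a continuous section of } p\right\}\right)\subset\mathbb{R}^{n-k}.$$ For polytopes $\Delta_0,\dots,\Delta_k\subset\mathbb{R}^n$, the mixed fiber polytope $F_p(\Delta_0,\dots,\Delta_k)$ is the coefficient of $\lambda_0\cdots\lambda_k$ in a homogeneous polynomial of degree $k+1$ in $\lambda_0,\dots,\lambda_k$, with polytopes in $\mathbb{R}^{n-k}$ as coefficients and Minkowski sum as addition, which equals $F_p(\lambda_0\Delta_0+\dots+\lambda_k\Delta_k)$ for all $\lambda_0,\dots,\lambda_k>0$. **Mixed subdivisions.** A point configuration in $\mathbb{Z}^d$ is a tuple $\mathcal{B}=(\mathcal{B}_0,\dots,\mathcal{B}_k)$ of finite nonempty subsets of $\mathbb{Z}^d$;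 put $\operatorname{conv}(\mathcal{B}):=\operatorname{conv}(\mathcal{B}_0+\dots+\mathcal{B}_k)$ and let $\dim(\mathcal{B})$ be the dimension of the affine span of $\mathcal{B}_0+\dots+\mathcal{B}_k$. A cell of $\mathcal{B}$ is a tuple $C=(C_0,\dots,C_k)$ with $\emptyset\ne C_i\subseteq\mathcal{B}_i$, and $\operatorname{conv}(C):=\operatorname{conv}(C_0+\dots+C_k)$. A face of $C$ is a cell of the form $C^\gamma=(C_0^\gamma,\dots,C_k^\gamma)$ for a covector $\gamma\in(\mathbb{R}^d)^*$, where $C_i^\gamma$ is the set of points of $C_i$ at which $\gamma$ is minimal. Put $$\operatorname{type}(C):=(\dim\operatorname{conv}(C_0),\dots,\dim\operatorname{conv}(C_k)).$$ A mixed subdivision of $\mathcal{B}$ is a finite set $S$ of cells of $\mathcal{B}$ such that 1. $\dim\operatorname{conv}(C)=\dim(\mathcal{B})$ for all $C\in S$; 2. for all $C,C'\in S$ with $\operatorname{conv}(C)\cap\operatorname{conv}(C')\ne\emptyset$ there is a cell $D$ that is a face of both $C$ and $C'$, with $\operatorname{conv}(C)\cap\operatorname{conv}(C')=\operatorname{conv}(D)$;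 3. $\bigcup_{C\in S}\operatorname{conv}(C)=\operatorname{conv}(\mathcal{B})$; 4. $\sum_{j=0}^k\dim\operatorname{conv}(C_j)=\dim(\mathcal{B})$ for all $C\in S$. **Lemma.** Let $\mathcal{A}=(\mathcal{A}_0,\dots,\mathcal{A}_k)$ be a point configuration in $\mathbb{Z}^n$, and let $\Delta_i:=\operatorname{conv}(\mathcal{A}_i)$. Assume that $p$ induces a bijection from $\Delta_0+\dots+\Delta_k$ to $p(\Delta_0+\dots+\Delta_k)$, and let $S$ be a mixed subdivision of $p(\mathcal{A}):=(p(\mathcal{A}_0),\dots,p(\mathcal{A}_k))$. Then $F_p(\Delta_0,\dots,\Delta_k)$ exists, is uniquely determined, consists of a single point, and $$F_p(\Delta_0,\dots,\Delta_k)=\sum_{i=0}^k\ \sum_{\substack{C\in S\\ \operatorname{type}(C)=\varepsilon_i}}\operatorname{vol}(C)\cdot\pi\left(p|_{\mathcal{A}_i}^{-1}(C_i)\right),$$ where $\varepsilon_i\in\mathbb{Z}^{k+1}$ has entry $0$ in position $i$ and $1$ everywhere else, $\operatorname{vol}(C)$ is the $k$-dimensional Lebesgue volume of $\operatorname{conv}(C)$,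 the sums on the right are Minkowski sums of subsets of $\mathbb{R}^{n-k}$, and an empty sum is $\{0\}$. -/

import Mathlib

open MeasureTheory
open scoped Pointwise

noncomputable section

namespace MixedFiber

/-! The ambient space is `ℝⁿ` with `n = m + k`, i.e. `m = n - k`. -/

/-- The projection `π : Rⁿ → Rⁿ⁻ᵏ` onto the first `m = n - k` coordinates. -/
def projFst (R : Type*) [Semiring R] (m k : ℕ) : (Fin (m + k) → R) →ₗ[R] (Fin m → R) :=
  LinearMap.funLeft R R (Fin.castAdd k)

/-- The projection `p : Rⁿ → Rᵏ` onto the last `k` coordinates. -/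
def projLast (R : Type*) [Semiring R] (m k : ℕ) : (Fin (m + k) → R) →ₗ[R] (Fin k → R) :=
  LinearMap.funLeft R R (Fin.natAdd m)

/-! ### Polytopes and mixed fiber polytopes -/

/-- A polytope is the convex hull of finitely many points. -/
def IsPolytope {d : ℕ} (P : Set (Fin d → ℝ)) : Prop :=
  ∃ s : Finset (Fin d → ℝ), P = convexHull ℝ (s : Set (Fin d → ℝ))

/-- The dimension of (the affine span of) a nonempty set. -/
def dim {d : ℕ} (P : Set (Fin d → ℝ)) : ℕ :=
  Module.finrank ℝ (affineSpan ℝ P).direction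

/-- `s` is a continuous section of `p` over `p(Δ)` with values in `Δ`
(only the restriction of `s` to `p(Δ)` is relevant). -/
def IsSection {m k : ℕ} (Δ : Set (Fin (m + k) → ℝ)) (s : (Fin k → ℝ) → (Fin (m + k) → ℝ)) :
    Prop :=
  ContinuousOn s (projLast ℝ m k '' Δ) ∧
    ∀ x ∈ projLast ℝ m k '' Δ, s x ∈ Δ ∧ projLast ℝ m k (s x) = x

/-- The Minkowski integral of `Δ`: all integrals over `p(Δ)` of continuous sections. -/
def minkowskiIntegral {m k : ℕ} (Δ : Set (Fin (m + k) → ℝ)) : Set (Fin (m + k) → ℝ) :=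
  {v | ∃ s : (Fin k → ℝ) → (Fin (m + k) → ℝ), IsSection Δ s ∧
    v = ∫ x in projLast ℝ m k '' Δ, s x}

/-- The fiber polytope of `Δ` with respect to `p`. -/
def fiberPolytope {m k : ℕ} (Δ : Set (Fin (m + k) → ℝ)) : Set (Fin m → ℝ) :=
  projFst ℝ m k '' minkowskiIntegral Δ

/-- `M` is the mixed fiber polytope of `Δ₀, …, Δₖ`: there is a homogeneous polynomial of degree
`k + 1` in `t₀, …, tₖ`, with polytopes as coefficients and Minkowski addition, that represents
`fiberPolytope (t₀ Δ₀ + ⋯ + tₖ Δₖ)`, and `M` is its coefficient at `t₀ ⋯ tₖ`. -/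
def IsMixedFiberPolytope {m k : ℕ} (Δ : Fin (k + 1) → Set (Fin (m + k) → ℝ))
    (M : Set (Fin m → ℝ)) : Prop :=
  ∃ c : (Fin (k + 1) → ℕ) → Set (Fin m → ℝ),
    (∀ e, IsPolytope (c e)) ∧
    (∀ t : Fin (k + 1) → ℝ, (∀ i, 0 < t i) →
      fiberPolytope (∑ i, t i • Δ i) =
        ∑ e ∈ Finset.piAntidiag (Finset.univ : Finset (Fin (k + 1))) (k + 1),
          (∏ i, t i ^ e i) • c e) ∧
    M = c (fun _ => 1)

/-! ### Point configurations and mixed subdivisions -/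

/-- The real point with the given integer coordinates. -/
def toReal {d : ℕ} (a : Fin d → ℤ) : Fin d → ℝ := fun j => (a j : ℝ)

/-- A finite set of integer points as a subset of `ℝᵈ`. -/
def realPts {d : ℕ} (s : Finset (Fin d → ℤ)) : Set (Fin d → ℝ) :=
  toReal '' (s : Set (Fin d → ℤ))

/-- The convex hull of a finite set of integer points. -/
def conv {d : ℕ} (s : Finset (Fin d → ℤ)) : Set (Fin d → ℝ) :=
  convexHull ℝ (realPts s)

/-- Tuples `(C₀, …, Cₖ)` of finite subsets of `ℤᵈ`: point configurations and their cells. -/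
abbrev Config (k d : ℕ) : Type := Fin (k + 1) → Finset (Fin d → ℤ)

/-- `conv(C) = conv(C₀ + ⋯ + Cₖ)`. -/
def cellConv {k d : ℕ} (C : Config k d) : Set (Fin d → ℝ) :=
  convexHull ℝ (∑ i, realPts (C i))

/-- `dim(𝒜)`, the dimension of the affine span of `𝒜₀ + ⋯ + 𝒜ₖ`. -/
def configDim {k d : ℕ} (A : Config k d) : ℕ := dim (∑ i, realPts (A i))

/-- `C` is a cell of the configuration `A` (with nonempty components). -/
def IsCell {k d : ℕ} (A C : Config k d) : Prop :=
  ∀ i, (C i).Nonempty ∧ C i ⊆ A i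

/-- The type of a cell. -/
def cellType {k d : ℕ} (C : Config k d) : Fin (k + 1) → ℕ := fun i => dim (conv (C i))

open Classical in
/-- The face `C^γ = (C₀^γ, …, Cₖ^γ)`, where `Cᵢ^γ` is the set of points of `Cᵢ` at which the
covector `γ` is minimal. -/
def face {k d : ℕ} (C : Config k d) (γ : Module.Dual ℝ (Fin d → ℝ)) : Config k d :=
  fun i => (C i).filter (fun a => ∀ b ∈ C i, γ (toReal a) ≤ γ (toReal b))

/-- The cell `D` is a face of the cell `C`. -/
def IsFace {k d : ℕ} (D C : Config k d) : Prop :=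
  ∃ γ : Module.Dual ℝ (Fin d → ℝ), D = face C γ

/-- `S` is a subdivision of the configuration `A`. In the second condition a face of a cell is a
tuple, so that two cells that meet share one and the same tuple as a face; the empty
intersection is allowed. -/
structure IsSubdivision {k d : ℕ} (A : Config k d) (S : Finset (Config k d)) : Prop where
  isCell : ∀ C ∈ S, IsCell A C
  dim_eq : ∀ C ∈ S, dim (cellConv C) = configDim A
  inter : ∀ C ∈ S, ∀ C' ∈ S, (cellConv C ∩ cellConv C').Nonempty →
    ∃ D : Config k d, IsFace D C ∧ IsFace D C' ∧ cellConv C ∩ cellConv C' = cellConv D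
  cover : ⋃ C ∈ S, cellConv C = cellConv A

/-- `S` is a mixed subdivision of `A`. -/
structure IsMixedSubdivision {k d : ℕ} (A : Config k d) (S : Finset (Config k d)) : Prop
    extends IsSubdivision A S where
  mixed : ∀ C ∈ S, ∑ j, dim (conv (C j)) = configDim A

/-- The configuration `p(𝒜) = (p(𝒜₀), …, p(𝒜ₖ))` in `ℤᵏ`. -/
def projConfig {m k : ℕ} (A : Config k (m + k)) : Config k k :=
  fun i => (A i).image (projLast ℤ m k)

/-- `εᵢ`: entry `0` in position `i` and `1` everywhere else. -/
def eps {k : ℕ} (i : Fin (k + 1)) : Fin (k + 1) → ℕ := fun j => if j = i then 0 else 1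

/-- `vol(C)`, the Lebesgue volume of `conv(C)`. -/
def cellVol {k d : ℕ} (C : Config k d) : ℝ := (volume (cellConv C)).toReal

/-- `π (p|_{𝒜ᵢ}⁻¹(Cᵢ))` as a subset of `ℝⁿ⁻ᵏ`. -/
def fiberImage {m k : ℕ} (A : Config k (m + k)) (C : Config k k) (i : Fin (k + 1)) :
    Set (Fin m → ℝ) :=
  projFst ℝ m k '' (toReal '' {a | a ∈ A i ∧ projLast ℤ m k a ∈ C i})

open Classical in
/-- The Minkowski sum `∑ᵢ ∑_{C ∈ S, type(C) = εᵢ} vol(C) · π (p|_{𝒜ᵢ}⁻¹(Cᵢ))`. -/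
def mixedCellSum {m k : ℕ} (A : Config k (m + k)) (S : Finset (Config k k)) :
    Set (Fin m → ℝ) :=
  ∑ i : Fin (k + 1), ∑ C ∈ S.filter (fun C => cellType C = eps i), cellVol C • fiberImage A C i

end MixedFiber

end

/-!
Since `p` is injective on `Δ₀ + ⋯ + Δₖ`, the projection `π` is an affine function `L ∘ p + bᵢ` of
`p` on each `Δᵢ`, with one linear part `L` (`MixedFiber.exists_projFst_eq`). So `t₀Δ₀ + ⋯ + tₖΔₖ`
has exactly one section, and its fiber polytope is the point `∫ (L x + ∑ tᵢ bᵢ) dx`, the integral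
being taken over `p(t₀Δ₀ + ⋯ + tₖΔₖ)` (`MixedFiber.fiberPolytope_sum_eq`).

This integral is computed cell by cell, which requires that `S`, a subdivision for the weights
`t = 1`, remains one when the cells are rescaled to `∑ tⱼ conv(Cⱼ)`, for all positive `t`. Let `U`
be the union over `C ∈ S` of the boxes `∏ conv(Cⱼ)`. By the conditions on `S`, the sum maps `U`
bijectively onto `∑ Qⱼ`, where `Qⱼ = p(Δⱼ)`, and the claim is that `u ↦ ∑ tⱼ uⱼ` maps `U`
bijectively onto `∑ tⱼ Qⱼ`. If this holds for `t`, write `u(x)` for the tuple with weighted sum `x`.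
For `sⱼ ∈ [0, 1]` and `yⱼ ∈ Qⱼ`, the tuples of `U` with `∑ sⱼ tⱼ uⱼ = ∑ sⱼ tⱼ yⱼ` correspond to
the fixed points of the self-map `x ↦ ∑ tⱼ ((1 - sⱼ) uⱼ(x) + sⱼ yⱼ)` of `∑ tⱼ Qⱼ`, which is a
contraction when `s` is close to `1`, so there is exactly one (`bijOn_weightedSum_mul`). How close
depends only on the norms of the projections onto the independent directions of the components of
the cells, not on `t`, so that finitely many steps and a homothety reach every positive weight
(`bijOn_weightedSum_of_one`). Rescaled cells overlap in null sets, because the overlaps lie in the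
hyperplanes that cut out proper common faces (`MixedFiber.IsMixedSubdivision.aedisjoint_scaledCell`).

A full-dimensional cell of type `d` is a direct sum of its components, so the change of variables
to the rescaled cell has determinant `∏ tⱼ ^ dⱼ`, and the cell contributes `∏ tⱼ ^ dⱼ` times a
linear form in `t` with vector coefficients (`MixedFiber.IsMixedSubdivision.exists_integral_eq`).
The monomial `t₀ ⋯ tₖ` arises exactly from the cells of type `εᵢ` and the coefficient of `tᵢ` in
their linear form. As `Cᵢ` is then a point `c`, that coefficient is `vol(C) (L c + bᵢ)`, where
`L c + bᵢ` is `π` of the point of `𝒜ᵢ` over `c`. If the configuration is not full-dimensional, the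
integral vanishes and no cell has type `εᵢ`. Uniqueness holds because any choice of points in the
coefficients of a competing polynomial satisfies the same polynomial identity on the positive
orthant.
-/

/-! ### Weighted sums of tuples and rescaling of tilings -/

section Tilings

/-- A function on an interval that is `K`-Lipschitz on each of finitely many closed sets covering
the interval is `K`-Lipschitz between the endpoints. -/
theorem norm_sub_le_of_closed_cover {E α : Type*} [NormedAddCommGroup E] (g : ℝ → E)
    (K : ℝ) (S : Finset α)
    (F : α → Set ℝ) (hF : ∀ i ∈ S, IsClosed (F i))
    (hg : ∀ i ∈ S, ∀ a ∈ F i, ∀ b ∈ F i, ‖g a - g b‖ ≤ K * |a - b|) {a b : ℝ} (hab : a ≤ b)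
    (hcov : Set.Icc a b ⊆ ⋃ i ∈ S, F i) : ‖g a - g b‖ ≤ K * (b - a) := by
  classical
  induction S using Finset.strongInduction generalizing a with
  | H S ih =>
    obtain ⟨i, hi, hai⟩ : ∃ i ∈ S, a ∈ F i := by
      simpa using hcov (Set.left_mem_Icc.2 hab)
    -- `c` is the last point of the interval that lies in the set containing `a`
    obtain ⟨c, ⟨hcF, hcI⟩, hmax⟩ := (isCompact_Icc.inter_left (hF i hi)).exists_isGreatest
      ⟨a, hai, Set.left_mem_Icc.2 hab⟩
    have h1 : ‖g a - g c‖ ≤ K * (c - a) := by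
      have := hg i hi a hai c hcF
      rwa [abs_sub_comm, abs_of_nonneg (sub_nonneg.2 hcI.1)] at this
    rcases hcI.2.eq_or_lt with hcb | hcb
    · rwa [← hcb]
    have hIoc : Set.Ioc c b ⊆ ⋃ j ∈ S.erase i, F j := by
      intro x hx
      obtain ⟨j, hj, hxj⟩ : ∃ j ∈ S, x ∈ F j := by
        simpa using hcov ⟨hcI.1.trans hx.1.le, hx.2⟩
      have hji : j ≠ i := by
        rintro rfl
        exact absurd (hmax ⟨hxj, hcI.1.trans hx.1.le, hx.2⟩) (not_le.2 hx.1)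
      exact Set.mem_biUnion (Finset.mem_coe.2 (Finset.mem_erase.2 ⟨hji, hj⟩)) hxj
    have hclosed : IsClosed (⋃ j ∈ S.erase i, F j) :=
      isClosed_biUnion_finset fun j hj => hF j (Finset.mem_of_mem_erase hj)
    have hIcc : Set.Icc c b ⊆ ⋃ j ∈ S.erase i, F j := by
      rw [← closure_Ioc hcb.ne]
      exact closure_minimal hIoc hclosed
    have h2 := ih (S.erase i) (Finset.erase_ssubset hi)
      (fun j hj => hF j (Finset.mem_of_mem_erase hj))
      (fun j hj => hg j (Finset.mem_of_mem_erase hj)) hcb.le hIcc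
    calc ‖g a - g b‖ ≤ ‖g a - g c‖ + ‖g c - g b‖ := norm_sub_le_norm_sub_add_norm_sub _ _ _
      _ ≤ K * (c - a) + K * (b - c) := add_le_add h1 h2
      _ = _ := by ring

variable {ι E : Type*} [Fintype ι] [NormedAddCommGroup E] [NormedSpace ℝ E]

/-- The continuous linear map `u ↦ ∑ j, t j • u j` on tuples of vectors. -/
noncomputable def weightedSum (t : ι → ℝ) : (ι → E) →L[ℝ] E :=
  ∑ j, t j • ContinuousLinearMap.proj j

@[simp]
theorem weightedSum_apply (t : ι → ℝ) (u : ι → E) : weightedSum t u = ∑ j, t j • u j := by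
  simp [weightedSum]

/-- One rescaling step. If `U` parametrizes `∑ t j • Q j` bijectively, with coordinates that are
Lipschitz functions of the sum, and `s` is close enough to `1`, then `U` parametrizes
`∑ s j t j • Q j` bijectively as well: the tuples of `U` with weighted sum `∑ s j t j • y j` are
the fixed points of a contraction of `∑ t j • Q j`. -/
theorem bijOn_weightedSum_mul {U : Set (ι → E)} {Q : ι → Set E} (hQ : ∀ j, Convex ℝ (Q j))
    (hQc : ∀ j, IsCompact (Q j)) (hUQ : U ⊆ Set.univ.pi Q) {s t : ι → ℝ} {K : ℝ}
    (hU : Set.BijOn (weightedSum t) U (weightedSum t '' Set.univ.pi Q))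
    (hs0 : ∀ j, 0 ≤ s j) (hs1 : ∀ j, s j ≤ 1)
    (hlip : ∀ u ∈ U, ∀ u' ∈ U, ∀ j,
      ‖t j • (u j - u' j)‖ ≤ K * ‖weightedSum t u - weightedSum t u'‖)
    (hK0 : 0 ≤ K) (hK : (∑ j, (1 - s j)) * K < 1) :
    Set.BijOn (weightedSum (s * t)) U (weightedSum (s * t) '' Set.univ.pi Q) := by
  have hs : ∀ j, 0 ≤ 1 - s j := fun j => sub_nonneg.2 (hs1 j)
  have hδ : 0 ≤ ∑ j, (1 - s j) := Finset.sum_nonneg fun j _ => hs j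
  have key : ∀ u ∈ U, ∀ u' ∈ U, ‖∑ j, (1 - s j) • (t j • (u j - u' j))‖ ≤
      ((∑ j, (1 - s j)) * K) * ‖weightedSum t u - weightedSum t u'‖ := by
    intro u hu u' hu'
    calc _ ≤ ∑ j, ‖(1 - s j) • (t j • (u j - u' j))‖ := norm_sum_le _ _
      _ ≤ ∑ j, (1 - s j) * (K * ‖weightedSum t u - weightedSum t u'‖) := by
        refine Finset.sum_le_sum fun j _ => ?_
        rw [norm_smul, Real.norm_of_nonneg (hs j)]
        exact mul_le_mul_of_nonneg_left (hlip u hu u' hu' j) (hs j)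
      _ = _ := by rw [← Finset.sum_mul, mul_assoc]
  refine ⟨fun u hu => ⟨u, hUQ hu, rfl⟩, ?_, ?_⟩
  · intro u hu u' hu' h
    have h1 : weightedSum t u - weightedSum t u' = ∑ j, (1 - s j) • (t j • (u j - u' j)) := by
      have : weightedSum (s * t) u - weightedSum (s * t) u' = 0 := sub_eq_zero.2 h
      simp only [weightedSum_apply, Pi.mul_apply] at this ⊢
      rw [← sub_zero (∑ j, t j • u j - ∑ j, t j • u' j), ← this]
      simp only [← Finset.sum_sub_distrib]
      exact Finset.sum_congr rfl fun j _ => by module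
    have h2 := key u hu u' hu'
    rw [← h1] at h2
    have h3 : ‖weightedSum t u - weightedSum t u'‖ = 0 := by
      nlinarith [norm_nonneg (weightedSum t u - weightedSum t u')]
    exact hU.injOn hu hu' (sub_eq_zero.1 (norm_eq_zero.1 h3))
  · rintro _ ⟨y, hy, rfl⟩
    obtain ⟨X, hXU, hX⟩ : ∃ X : E → ι → E, (∀ x ∈ weightedSum t '' Set.univ.pi Q, X x ∈ U) ∧
        ∀ x ∈ weightedSum t '' Set.univ.pi Q, weightedSum t (X x) = x :=
      ⟨Function.invFunOn (weightedSum t) U,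
        fun x hx => Function.invFunOn_mem (hU.surjOn hx),
        fun x hx => Function.invFunOn_eq (hU.surjOn hx)⟩
    set D := weightedSum t '' Set.univ.pi Q with hD
    let T : E → E := fun x => weightedSum t (fun j => (1 - s j) • X x j + s j • y j)
    have hT : Set.MapsTo T D D := by
      intro x hx
      refine ⟨_, fun j hj => ?_, rfl⟩
      exact hQ j (hUQ (hXU x hx) j hj) (hy j hj) (hs j) (hs0 j) (by ring)
    have hcomplete : IsComplete D :=
      ((isCompact_univ_pi hQc).image (weightedSum t).continuous).isComplete
    have hcontr : ContractingWith ⟨(∑ j, (1 - s j)) * K, mul_nonneg hδ hK0⟩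
        (hT.restrict T D D) := by
      refine ⟨by exact_mod_cast hK, LipschitzWith.of_dist_le_mul ?_⟩
      rintro ⟨x, hx⟩ ⟨x', hx'⟩
      rw [Subtype.dist_eq, Subtype.dist_eq, dist_eq_norm, dist_eq_norm]
      have h := key _ (hXU x hx) _ (hXU x' hx')
      rw [hX x hx, hX x' hx'] at h
      refine le_of_eq_of_le (congrArg norm ?_) h
      simp only [Set.MapsTo.val_restrict_apply, T, weightedSum_apply, ← Finset.sum_sub_distrib]
      exact Finset.sum_congr rfl fun j _ => by module
    obtain ⟨x, hx, hfix, -⟩ := hcontr.exists_fixedPoint' hcomplete hT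
      (x := weightedSum t y) ⟨y, hy, rfl⟩ (edist_ne_top _ _)
    refine ⟨X x, hXU x hx, ?_⟩
    have h1 : T x = weightedSum t (X x) := hfix.eq.trans (hX x hx).symm
    have h2 := sub_eq_zero.2 h1
    simp only [T, weightedSum_apply, Pi.mul_apply] at h2 ⊢
    rw [← sub_eq_zero, ← neg_eq_zero, ← h2, ← Finset.sum_sub_distrib, ← Finset.sum_sub_distrib,
      ← Finset.sum_neg_distrib]
    exact Finset.sum_congr rfl fun j _ => by module

/-- If a finite union of boxes of compact sets parametrizes the convex set `∑ t j • Q j`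
bijectively, a Lipschitz bound valid on each box holds on the whole union. -/
theorem norm_smul_sub_le_of_bijOn {α : Type*} {S : Finset α} {P : α → ι → Set E}
    {Q : ι → Set E} (hP : ∀ C ∈ S, ∀ j, IsCompact (P C j)) (hQ : ∀ j, Convex ℝ (Q j))
    {t : ι → ℝ} {K : ℝ}
    (hU : Set.BijOn (weightedSum t) (⋃ C ∈ S, Set.univ.pi (P C)) (weightedSum t '' Set.univ.pi Q))
    (hlip : ∀ C ∈ S, ∀ u ∈ Set.univ.pi (P C), ∀ u' ∈ Set.univ.pi (P C), ∀ j,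
      ‖t j • (u j - u' j)‖ ≤ K * ‖weightedSum t u - weightedSum t u'‖)
    {u u' : ι → E} (hu : u ∈ ⋃ C ∈ S, Set.univ.pi (P C))
    (hu' : u' ∈ ⋃ C ∈ S, Set.univ.pi (P C)) (j : ι) :
    ‖t j • (u j - u' j)‖ ≤ K * ‖weightedSum t u - weightedSum t u'‖ := by
  set U := ⋃ C ∈ S, Set.univ.pi (P C) with hUdef
  set X := Function.invFunOn (weightedSum t) U
  have hX : ∀ w ∈ U, X (weightedSum t w) = w := fun w hw => hU.injOn.leftInvOn_invFunOn hw
  set x := weightedSum t u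
  set x' := weightedSum t u'
  let ℓ : ℝ → E := fun r => AffineMap.lineMap x x' r
  have hℓ : Continuous ℓ := AffineMap.lineMap_continuous
  have hconv : Convex ℝ (weightedSum t '' Set.univ.pi Q) :=
    (convex_pi fun j _ => hQ j).linear_image (weightedSum t).toLinearMap
  have h := norm_sub_le_of_closed_cover (fun r => t j • X (ℓ r) j) (K * ‖x - x'‖) S
    (fun C => ℓ ⁻¹' (weightedSum t '' Set.univ.pi (P C)))
    (fun C hC => (((isCompact_univ_pi (hP C hC)).image
      (weightedSum t).continuous).isClosed).preimage hℓ) ?_ zero_le_one ?_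
  · simpa only [ℓ, AffineMap.lineMap_apply_zero, AffineMap.lineMap_apply_one, x, x', hX u hu,
      hX u' hu', ← smul_sub, sub_zero, mul_one] using h
  · rintro C hC a ⟨w, hw, hwa⟩ b ⟨w', hw', hwb⟩
    have hwU : w ∈ U := Set.mem_biUnion (Finset.mem_coe.2 hC) hw
    have hwU' : w' ∈ U := Set.mem_biUnion (Finset.mem_coe.2 hC) hw'
    have h1 := hlip C hC w hw w' hw' j
    have h2 : ‖ℓ a - ℓ b‖ = |a - b| * ‖x - x'‖ := by
      rw [← dist_eq_norm, dist_lineMap_lineMap, dist_eq_norm, dist_eq_norm, Real.norm_eq_abs]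
    simp only [← hwa, ← hwb, hX w hwU, hX w' hwU', ← smul_sub]
    rw [hwa, hwb, h2] at h1
    linarith
  · intro r hr
    obtain ⟨w, hw, hwr⟩ := hU.surjOn
      (hconv.lineMap_mem (hU.mapsTo hu) (hU.mapsTo hu') hr)
    obtain ⟨C, hC, hwC⟩ := Set.mem_iUnion₂.1 hw
    exact Set.mem_iUnion₂.2 ⟨C, hC, w, hwC, hwr⟩

theorem bijOn_weightedSum_smul {U : Set (ι → E)} {Q : ι → Set E} {t : ι → ℝ} {c : ℝ} (hc : c ≠ 0)
    (hU : Set.BijOn (weightedSum t) U (weightedSum t '' Set.univ.pi Q)) :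
    Set.BijOn (weightedSum (c • t)) U (weightedSum (c • t) '' Set.univ.pi Q) := by
  have h : (weightedSum (c • t) : (ι → E) → E) = (fun x => c • x) ∘ weightedSum t := by
    ext u
    simp [Finset.smul_sum, smul_smul]
  rw [h, Set.image_comp]
  exact ((smul_right_injective E hc).injOn.bijOn_image).comp hU

/-- A finite union of boxes that parametrizes `∑ Q j` bijectively, each box with coordinates that
are Lipschitz functions of every weighted sum, parametrizes `∑ t j • Q j` bijectively for all
positive weights `t`. After scaling, the weights lie in `(0, 1]`; they are reached from `1` by
finitely many steps close to `1`, and the Lipschitz constant does not deteriorate on the way. -/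
theorem bijOn_weightedSum_of_one {α : Type*} {S : Finset α} {P : α → ι → Set E} {Q : ι → Set E}
    (hP : ∀ C ∈ S, ∀ j, IsCompact (P C j)) (hPQ : ∀ C ∈ S, ∀ j, P C j ⊆ Q j)
    (hQ : ∀ j, Convex ℝ (Q j)) (hQc : ∀ j, IsCompact (Q j)) {K : ℝ} (hK0 : 0 ≤ K)
    (hlip : ∀ C ∈ S, ∀ u ∈ Set.univ.pi (P C), ∀ u' ∈ Set.univ.pi (P C), ∀ (t : ι → ℝ) (j : ι),
      ‖t j • (u j - u' j)‖ ≤ K * ‖weightedSum t u - weightedSum t u'‖)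
    (hU : Set.BijOn (weightedSum 1) (⋃ C ∈ S, Set.univ.pi (P C))
      (weightedSum 1 '' Set.univ.pi Q)) {t : ι → ℝ} (ht : ∀ j, 0 < t j) :
    Set.BijOn (weightedSum t) (⋃ C ∈ S, Set.univ.pi (P C)) (weightedSum t '' Set.univ.pi Q) := by
  set U := ⋃ C ∈ S, Set.univ.pi (P C) with hUdef
  have hUQ : U ⊆ Set.univ.pi Q :=
    Set.iUnion₂_subset fun C hC u hu j hj => hPQ C hC j (hu j hj)
  -- a common upper bound for the weights
  set M := 1 + ∑ j, t j with hM
  have hM0 : 0 < M := add_pos_of_pos_of_nonneg one_pos (Finset.sum_nonneg fun j _ => (ht j).le)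
  have htM : ∀ j, t j / M ≤ 1 := fun j => by
    rw [div_le_one hM0]
    have := Finset.single_le_sum (f := t) (fun i _ => (ht i).le) (Finset.mem_univ j)
    linarith
  have hr0 : ∀ j, 0 < t j / M := fun j => div_pos (ht j) hM0
  -- the `N`-th roots of the weights, for large `N`, are as close to `1` as required
  have hlim : Filter.Tendsto
      (fun N : ℕ => (∑ j, (1 - (t j / M) ^ ((N : ℝ)⁻¹))) * K) Filter.atTop (nhds 0) := by
    have h1 : ∀ j, Filter.Tendsto (fun N : ℕ => 1 - (t j / M) ^ ((N : ℝ)⁻¹)) Filter.atTop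
        (nhds 0) := by
      intro j
      have h2 : Filter.Tendsto (fun N : ℕ => (t j / M) ^ ((N : ℝ)⁻¹)) Filter.atTop
          (nhds ((t j / M) ^ (0 : ℝ))) :=
        (Real.continuousAt_const_rpow (hr0 j).ne').tendsto.comp
          tendsto_inv_atTop_nhds_zero_nat
      simpa using h2.const_sub 1
    simpa using (tendsto_finsetSum Finset.univ fun j _ => h1 j).mul_const K
  obtain ⟨N, hN1, hN0⟩ := ((hlim.eventually_lt_const one_pos).and
    (Filter.eventually_gt_atTop 0)).exists
  set s : ι → ℝ := fun j => (t j / M) ^ ((N : ℝ)⁻¹)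
  have hs0 : ∀ j, 0 ≤ s j := fun j => Real.rpow_nonneg (hr0 j).le _
  have hs1 : ∀ j, s j ≤ 1 := fun j => Real.rpow_le_one (hr0 j).le (htM j) (by positivity)
  have hpow : ∀ n : ℕ, Set.BijOn (weightedSum (s ^ n)) U
      (weightedSum (s ^ n) '' Set.univ.pi Q) := by
    intro n
    induction n with
    | zero => simpa using hU
    | succ n ih =>
      rw [pow_succ']
      refine bijOn_weightedSum_mul hQ hQc hUQ ih hs0 hs1 (fun u hu u' hu' j => ?_) hK0 hN1
      exact norm_smul_sub_le_of_bijOn hP hQ ih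
        (fun C hC u hu u' hu' j => hlip C hC u hu u' hu' _ j) hu hu' j
  have hsN : M • s ^ N = t := by
    ext j
    have : s j ^ N = t j / M := by
      rw [← Real.rpow_natCast, ← Real.rpow_mul (hr0 j).le, inv_mul_cancel₀ (by positivity),
        Real.rpow_one]
    simp only [Pi.smul_apply, Pi.pow_apply, this, smul_eq_mul]
    field_simp
  rw [← hsN]
  exact bijOn_weightedSum_smul hM0.ne' (hpow N)

end Tilings

/-! ### Minkowski sums of sets in independent directions -/

section Independent

variable {ι E : Type*} [Fintype ι] [NormedAddCommGroup E] [NormedSpace ℝ E]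

/-- The summation map from a product of subspaces to the ambient space. -/
noncomputable def sumOfSubmodules (V : ι → Submodule ℝ E) : (∀ j, V j) →ₗ[ℝ] E :=
  ∑ j, (V j).subtype ∘ₗ LinearMap.proj j

@[simp]
theorem sumOfSubmodules_apply (V : ι → Submodule ℝ E) (v : ∀ j, V j) :
    sumOfSubmodules V v = ∑ j, (v j : E) := by
  simp [sumOfSubmodules]

theorem iSup_le_range_sumOfSubmodules (V : ι → Submodule ℝ E) :
    ⨆ j, V j ≤ (sumOfSubmodules V).range := by
  classical
  refine iSup_le fun j v hv => ⟨Pi.single j ⟨v, hv⟩, ?_⟩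
  rw [sumOfSubmodules_apply, Finset.sum_eq_single j]
  · simp
  · intro i _ hij
    simp [hij]
  · simp

variable [FiniteDimensional ℝ E]

/-- Subspaces whose dimensions add up to the dimension of a subspace of their sum are independent. -/
theorem ker_sumOfSubmodules {V : ι → Submodule ℝ E} {W : Submodule ℝ E}
    (hW : W ≤ ⨆ j, V j) (h : ∑ j, Module.finrank ℝ (V j) = Module.finrank ℝ W) :
    (sumOfSubmodules V).ker = ⊥ := by
  have h1 := (sumOfSubmodules V).finrank_range_add_finrank_ker
  rw [Module.finrank_pi_fintype, h] at h1
  have h2 := Submodule.finrank_mono (hW.trans (iSup_le_range_sumOfSubmodules V))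
  exact Submodule.finrank_eq_zero.1 (by omega)

/-- In a sum of sets in independent directions, the summands of a weighted sum are Lipschitz
functions of it, with a constant that does not depend on the weights. -/
theorem exists_norm_smul_sub_le {P : ι → Set E}
    (hker : (sumOfSubmodules fun j => vectorSpan ℝ (P j)).ker = ⊥) :
    ∃ K : ℝ, 0 ≤ K ∧ ∀ u ∈ Set.univ.pi P, ∀ u' ∈ Set.univ.pi P, ∀ (t : ι → ℝ) (j : ι),
      ‖t j • (u j - u' j)‖ ≤ K * ‖weightedSum t u - weightedSum t u'‖ := by
  obtain ⟨K, -, hK⟩ := (sumOfSubmodules fun j => vectorSpan ℝ (P j)).exists_antilipschitzWith hker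
  refine ⟨K, K.2, fun u hu u' hu' t j => ?_⟩
  let v : ∀ j, vectorSpan ℝ (P j) := fun j =>
    t j • ⟨u j - u' j, vsub_mem_vectorSpan ℝ (hu j trivial) (hu' j trivial)⟩
  have h1 := hK.le_mul_dist v 0
  rw [map_zero, dist_zero_right, dist_zero_right] at h1
  have h2 : sumOfSubmodules (fun j => vectorSpan ℝ (P j)) v =
      weightedSum t u - weightedSum t u' := by
    simp [v, smul_sub]
  rw [h2] at h1
  exact (norm_le_pi_norm v j).trans h1

theorem weightedSum_injOn {P : ι → Set E}
    (hker : (sumOfSubmodules fun j => vectorSpan ℝ (P j)).ker = ⊥) {t : ι → ℝ}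
    (ht : ∀ j, t j ≠ 0) : Set.InjOn (weightedSum t) (Set.univ.pi P) := by
  intro u hu u' hu' h
  obtain ⟨K, -, hK⟩ := exists_norm_smul_sub_le hker
  ext1 j
  have := hK u hu u' hu' t j
  rw [h, sub_self, norm_zero, mul_zero, norm_le_zero_iff, smul_eq_zero] at this
  exact sub_eq_zero.1 (this.resolve_left (ht j))

theorem det_pi_smul_proj (V : ι → Submodule ℝ E) (t : ι → ℝ) :
    LinearMap.det (LinearMap.pi fun j => t j • LinearMap.proj j : (∀ j, V j) →ₗ[ℝ] ∀ j, V j) =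
      ∏ j, t j ^ Module.finrank ℝ (V j) := by
  classical
  let b := Pi.basis fun j => Module.finBasis ℝ (V j)
  have h : LinearMap.toMatrix b b (LinearMap.pi fun j => t j • LinearMap.proj j) =
      Matrix.diagonal fun i => t i.1 := by
    ext ⟨i, i'⟩ ⟨j, j'⟩
    rw [LinearMap.toMatrix_apply, Matrix.diagonal_apply, Pi.basis_repr]
    by_cases hij : i = j
    · subst hij
      simp [b, Finsupp.single_apply, eq_comm]
    · simp [b, hij]
  rw [← LinearMap.det_toMatrix b, h, Matrix.det_diagonal, Fintype.prod_sigma]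
  simp

/-- Change of variables between `∑ P j` and `∑ t j • P j` for sets `P j` in complementary
directions. The function `X` recovers the summands of a point of `∑ P j`. -/
theorem exists_summands_integral_eq [MeasurableSpace E] [BorelSpace E] (μ : Measure E)
    [μ.IsAddHaarMeasure] {F : Type*} [NormedAddCommGroup F] [NormedSpace ℝ F]
    {P : ι → Set E} (hP : ∀ j, IsCompact (P j)) (hne : ∀ j, (P j).Nonempty)
    (hker : (sumOfSubmodules fun j => vectorSpan ℝ (P j)).ker = ⊥)
    (hdim : ∑ j, Module.finrank ℝ (vectorSpan ℝ (P j)) = Module.finrank ℝ E) :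
    ∃ X : E → ι → E, Continuous X ∧ (∀ u ∈ Set.univ.pi P, X (weightedSum 1 u) = u) ∧
      ∀ t : ι → ℝ, (∀ j, 0 < t j) → ∀ f : E → F,
        ∫ x in weightedSum t '' Set.univ.pi P, f x ∂μ =
          (∏ j, t j ^ Module.finrank ℝ (vectorSpan ℝ (P j))) •
            ∫ x in weightedSum 1 '' Set.univ.pi P, f (weightedSum t (X x)) ∂μ := by
  choose c hc using hne
  set V : ι → Submodule ℝ E := fun j => vectorSpan ℝ (P j)
  let e : (∀ j, V j) ≃ₗ[ℝ] E := LinearMap.linearEquivOfInjective (sumOfSubmodules V)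
    (LinearMap.ker_eq_bot.1 hker) (by rw [Module.finrank_pi_fintype]; exact hdim)
  have he : ∀ v, e v = ∑ j, (v j : E) := fun v => sumOfSubmodules_apply V v
  let X : E → ι → E := fun x j => c j + (e.symm (x - ∑ i, c i) j : E)
  have hXc : Continuous X := by
    have : Continuous e.symm := e.symm.toLinearMap.continuous_of_finiteDimensional
    exact continuous_pi fun j => continuous_const.add (continuous_subtype_val.comp
      ((continuous_apply j).comp (this.comp (continuous_id.sub continuous_const))))
  have hX : ∀ u ∈ Set.univ.pi P, X (weightedSum 1 u) = u := by
    intro u hu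
    let v : ∀ j, V j := fun j => ⟨u j - c j, vsub_mem_vectorSpan ℝ (hu j trivial) (hc j)⟩
    have hv : weightedSum 1 u - ∑ i, c i = e v := by simp [he, v]
    ext1 j
    simp only [X]
    rw [hv, e.symm_apply_apply]
    simp [v]
  refine ⟨X, hXc, hX, fun t ht f => ?_⟩
  let Φ : E →ₗ[ℝ] E :=
    e.toLinearMap ∘ₗ (LinearMap.pi fun j => t j • LinearMap.proj j) ∘ₗ e.symm.toLinearMap
  have hΦ : ∀ x, weightedSum t (X x) =
      LinearMap.toContinuousLinearMap Φ (x - ∑ i, c i) + weightedSum t c := by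
    intro x
    simp only [X, Φ]
    generalize x - ∑ i, c i = y
    simp [he, smul_add, Finset.sum_add_distrib, add_comm]
  have hderiv : ∀ x ∈ weightedSum 1 '' Set.univ.pi P, HasFDerivWithinAt
      (fun x => weightedSum t (X x)) (LinearMap.toContinuousLinearMap Φ)
      (weightedSum 1 '' Set.univ.pi P) x := by
    intro x _
    simp only [hΦ]
    exact (((LinearMap.toContinuousLinearMap Φ).hasFDerivAt.comp x
      ((hasFDerivAt_id x).sub_const _)).add_const _).hasFDerivWithinAt
  have hinj : Set.InjOn (fun x => weightedSum t (X x)) (weightedSum 1 '' Set.univ.pi P) := by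
    rintro _ ⟨u, hu, rfl⟩ _ ⟨u', hu', rfl⟩ h
    simp only [hX u hu, hX u' hu'] at h
    rw [weightedSum_injOn hker (fun j => (ht j).ne') hu hu' h]
  have himage : (fun x => weightedSum t (X x)) '' (weightedSum 1 '' Set.univ.pi P) =
      weightedSum t '' Set.univ.pi P := by
    rw [Set.image_image]
    exact Set.image_congr fun u hu => by rw [hX u hu]
  have hmeas : MeasurableSet (weightedSum 1 '' Set.univ.pi P : Set E) :=
    ((isCompact_univ_pi hP).image (weightedSum 1).continuous).measurableSet
  have hdet : |(LinearMap.toContinuousLinearMap Φ).det| =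
      ∏ j, t j ^ Module.finrank ℝ (V j) := by
    rw [LinearMap.det_toContinuousLinearMap, LinearMap.det_conj, det_pi_smul_proj]
    exact abs_of_nonneg (Finset.prod_nonneg fun j _ => pow_nonneg (ht j).le _)
  rw [← himage, integral_image_eq_integral_abs_det_fderiv_smul μ hmeas hderiv hinj, hdet,
    integral_smul]

end Independent

/-! ### Mixed subdivisions and their rescalings -/

section SetSums

variable {ι E : Type*} [Fintype ι] [NormedAddCommGroup E] [NormedSpace ℝ E]

theorem sum_smul_eq_image_weightedSum (t : ι → ℝ) (P : ι → Set E) :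
    ∑ i, t i • P i = weightedSum t '' Set.univ.pi P := by
  ext x
  rw [Set.mem_finsetSum]
  constructor
  · rintro ⟨g, hg, rfl⟩
    choose u hu hug using fun i => hg (Finset.mem_univ i)
    exact ⟨u, fun i _ => hu i, by simpa using Finset.sum_congr rfl fun i _ => hug i⟩
  · rintro ⟨u, hu, rfl⟩
    exact ⟨fun i => t i • u i, fun _ => Set.smul_mem_smul_set (hu _ trivial), by simp⟩

theorem sum_eq_image_weightedSum_one (P : ι → Set E) :
    ∑ i, P i = weightedSum 1 '' Set.univ.pi P := by
  rw [← sum_smul_eq_image_weightedSum]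
  simp

theorem vectorSpan_image_weightedSum_le (t : ι → ℝ) (P : ι → Set E) :
    vectorSpan ℝ (weightedSum t '' Set.univ.pi P) ≤ ⨆ j, vectorSpan ℝ (P j) := by
  rw [vectorSpan_def, Submodule.span_le]
  rintro _ ⟨_, ⟨u, hu, rfl⟩, _, ⟨u', hu', rfl⟩, rfl⟩
  have h : weightedSum t u - weightedSum t u' = ∑ j, t j • (u j - u' j) := by
    simp [smul_sub]
  simp only [vsub_eq_sub, SetLike.mem_coe, h]
  exact Submodule.sum_mem _ fun j _ => Submodule.smul_mem _ _
    ((le_iSup (fun j => vectorSpan ℝ (P j)) j)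
      (vsub_mem_vectorSpan ℝ (hu j trivial) (hu' j trivial)))

theorem addHaar_image_weightedSum_eq_zero [FiniteDimensional ℝ E] [MeasurableSpace E]
    [BorelSpace E] (μ : Measure E) [μ.IsAddHaarMeasure] (t : ι → ℝ) {P : ι → Set E}
    (h : ∑ j, Module.finrank ℝ (vectorSpan ℝ (P j)) < Module.finrank ℝ E) :
    μ (weightedSum t '' Set.univ.pi P) = 0 := by
  refine measure_mono_null (subset_affineSpan ℝ _)
    (Measure.addHaar_affineSubspace μ _ fun htop => ?_)
  have h1 := congrArg AffineSubspace.direction htop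
  rw [direction_affineSpan, AffineSubspace.direction_top] at h1
  have h2 := (vectorSpan_image_weightedSum_le t P)
  rw [h1] at h2
  have h3 := Submodule.finrank_mono (h2.trans (iSup_le_range_sumOfSubmodules _))
  have h4 := (sumOfSubmodules fun j => vectorSpan ℝ (P j)).finrank_range_le
  rw [finrank_top] at h3
  rw [Module.finrank_pi_fintype] at h4
  omega

end SetSums

namespace MixedFiber

variable {k d : ℕ}

theorem dim_eq (P : Set (Fin d → ℝ)) : dim P = Module.finrank ℝ (vectorSpan ℝ P) := by
  rw [dim, direction_affineSpan]

theorem isCompact_conv (s : Finset (Fin d → ℤ)) : IsCompact (conv s) :=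
  ((s.finite_toSet).image _).isCompact_convexHull ℝ

theorem convex_conv (s : Finset (Fin d → ℤ)) : Convex ℝ (conv s) := convex_convexHull ℝ _

theorem conv_mono {s s' : Finset (Fin d → ℤ)} (h : s ⊆ s') : conv s ⊆ conv s' :=
  convexHull_mono (Set.image_mono (by exact_mod_cast h))

theorem conv_nonempty {s : Finset (Fin d → ℤ)} (h : s.Nonempty) : (conv s).Nonempty :=
  (Set.Nonempty.image _ (by exact_mod_cast h)).convexHull

/-- The Minkowski sum `∑ t j • conv (C j)`: the cell `C` with its components rescaled by `t`. -/
noncomputable def scaledCell (t : Fin (k + 1) → ℝ) (C : Config k d) : Set (Fin d → ℝ) :=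
  weightedSum t '' Set.univ.pi fun j => conv (C j)

theorem isCompact_scaledCell (t : Fin (k + 1) → ℝ) (C : Config k d) :
    IsCompact (scaledCell t C) :=
  (isCompact_univ_pi fun j => isCompact_conv (C j)).image (weightedSum t).continuous

theorem cellConv_eq (C : Config k d) : cellConv C = scaledCell 1 C := by
  rw [cellConv, convexHull_sum, sum_eq_image_weightedSum_one]
  rfl

theorem face_zero (C : Config k d) : face C 0 = C := by
  ext i a
  simp [face]

theorem face_subset (C : Config k d) (γ : Module.Dual ℝ (Fin d → ℝ)) (i : Fin (k + 1)) :
    face C γ i ⊆ C i := by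
  simp [face]

theorem exists_eq_on_conv_face (C : Config k d) (γ : Module.Dual ℝ (Fin d → ℝ))
    (i : Fin (k + 1)) : ∃ r : ℝ, ∀ x ∈ conv (face C γ i), γ x = r := by
  rcases (face C γ i).eq_empty_or_nonempty with h | ⟨a, ha⟩
  · exact ⟨0, by simp [h, conv, realPts]⟩
  · refine ⟨γ (toReal a), fun x hx => ?_⟩
    refine convexHull_min ?_ (convex_hyperplane γ.isLinear (γ (toReal a))) hx
    rintro _ ⟨b, hb, rfl⟩
    simp only [face, Finset.coe_filter, Finset.mem_filter, Set.mem_ofPred_eq] at ha hb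
    exact le_antisymm (hb.2 a ha.1) (ha.2 b hb.1)

variable {B : Config k d} {S : Finset (Config k d)}

theorem IsMixedSubdivision.ker_eq_bot (hS : IsMixedSubdivision B S) {C : Config k d} (hC : C ∈ S) :
    (sumOfSubmodules fun j => vectorSpan ℝ (conv (C j))).ker = ⊥ := by
  refine ker_sumOfSubmodules (vectorSpan_image_weightedSum_le 1 fun j => conv (C j)) ?_
  have h1 := hS.mixed C hC
  rw [← hS.dim_eq C hC, cellConv_eq, dim_eq] at h1
  simp only [dim_eq] at h1
  exact h1

theorem IsMixedSubdivision.exists_lipschitz (hS : IsMixedSubdivision B S) :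
    ∃ K : ℝ, 0 ≤ K ∧ ∀ C ∈ S, ∀ u ∈ Set.univ.pi (fun j => conv (C j)),
      ∀ u' ∈ Set.univ.pi (fun j => conv (C j)), ∀ (t : Fin (k + 1) → ℝ) (j : Fin (k + 1)),
      ‖t j • (u j - u' j)‖ ≤ K * ‖weightedSum t u - weightedSum t u'‖ := by
  have h : ∀ C : S, _ := fun C => exists_norm_smul_sub_le (hS.ker_eq_bot C.2)
  choose K hK0 hK using h
  refine ⟨∑ C, K C, Finset.sum_nonneg fun C _ => hK0 C, fun C hC u hu u' hu' t j => ?_⟩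
  refine (hK ⟨C, hC⟩ u hu u' hu' t j).trans (mul_le_mul_of_nonneg_right ?_ (norm_nonneg _))
  exact Finset.single_le_sum (f := K) (fun C _ => hK0 C) (Finset.mem_univ _)

/-- The tuples of points of the cells of a mixed subdivision parametrize the Minkowski sum
bijectively: two tuples with the same sum lie in the common face of their cells. -/
theorem IsMixedSubdivision.bijOn_one (hS : IsMixedSubdivision B S) :
    Set.BijOn (weightedSum 1) (⋃ C ∈ S, Set.univ.pi fun j => conv (C j))
      (weightedSum 1 '' Set.univ.pi fun j => conv (B j)) := by
  refine ⟨?_, ?_, ?_⟩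
  · intro u hu
    obtain ⟨C, hC, huC⟩ := Set.mem_iUnion₂.1 hu
    exact ⟨u, fun j hj => conv_mono (hS.isCell C hC j).2 (huC j hj), rfl⟩
  · intro u hu u' hu' h
    obtain ⟨C, hC, huC⟩ := Set.mem_iUnion₂.1 hu
    obtain ⟨C', hC', huC'⟩ := Set.mem_iUnion₂.1 hu'
    have hx : weightedSum 1 u ∈ cellConv C := by
      rw [cellConv_eq]; exact ⟨u, huC, rfl⟩
    have hx' : weightedSum 1 u ∈ cellConv C' := by
      rw [cellConv_eq]; exact ⟨u', huC', h.symm⟩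
    obtain ⟨D, ⟨γ, hγ⟩, ⟨γ', hγ'⟩, hD⟩ := hS.inter C hC C' hC' ⟨_, hx, hx'⟩
    have hxD : weightedSum 1 u ∈ cellConv D := hD ▸ ⟨hx, hx'⟩
    rw [cellConv_eq] at hxD
    obtain ⟨v, hv, hvu⟩ := hxD
    have h1 : v = u := weightedSum_injOn (hS.ker_eq_bot hC) (fun _ => one_ne_zero)
      (fun j hj => conv_mono (hγ ▸ face_subset C γ j) (hv j hj)) huC hvu
    have h2 : v = u' := weightedSum_injOn (hS.ker_eq_bot hC') (fun _ => one_ne_zero)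
      (fun j hj => conv_mono (hγ' ▸ face_subset C' γ' j) (hv j hj)) huC' (hvu.trans h)
    exact h1.symm.trans h2
  · intro x hx
    have hx' : x ∈ ⋃ C ∈ S, cellConv C := by
      rw [hS.cover, cellConv_eq]; exact hx
    obtain ⟨C, hC, hxC⟩ := Set.mem_iUnion₂.1 hx'
    rw [cellConv_eq] at hxC
    obtain ⟨u, hu, hux⟩ := hxC
    exact ⟨u, Set.mem_iUnion₂.2 ⟨C, hC, hu⟩, hux⟩

theorem IsMixedSubdivision.bijOn (hS : IsMixedSubdivision B S) {t : Fin (k + 1) → ℝ}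
    (ht : ∀ j, 0 < t j) :
    Set.BijOn (weightedSum t) (⋃ C ∈ S, Set.univ.pi fun j => conv (C j))
      (weightedSum t '' Set.univ.pi fun j => conv (B j)) := by
  obtain ⟨K, hK0, hK⟩ := hS.exists_lipschitz
  exact bijOn_weightedSum_of_one (P := fun (C : Config k d) j => conv (C j))
    (Q := fun j => conv (B j)) (fun C _ j => isCompact_conv (C j))
    (fun C hC j => conv_mono (hS.isCell C hC j).2) (fun j => convex_conv (B j))
    (fun j => isCompact_conv (B j)) hK0 hK hS.bijOn_one ht

theorem IsMixedSubdivision.biUnion_scaledCell (hS : IsMixedSubdivision B S)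
    {t : Fin (k + 1) → ℝ} (ht : ∀ j, 0 < t j) : ⋃ C ∈ S, scaledCell t C = scaledCell t B := by
  rw [scaledCell, ← (hS.bijOn ht).image_eq, Set.image_iUnion₂]
  rfl

/-- Distinct rescaled cells overlap in a null set: the overlap lies in the hyperplane that cuts
out the common face from one of the two cells. -/
theorem IsMixedSubdivision.aedisjoint_scaledCell (hS : IsMixedSubdivision B S)
    {t : Fin (k + 1) → ℝ} (ht : ∀ j, 0 < t j) {C C' : Config k d} (hC : C ∈ S) (hC' : C' ∈ S)
    (hne : C ≠ C') : AEDisjoint volume (scaledCell t C) (scaledCell t C') := by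
  -- every point of the overlap comes from a single tuple lying in both cells
  have hmem : ∀ y ∈ scaledCell t C ∩ scaledCell t C', ∃ u, u ∈ Set.univ.pi (fun j => conv (C j)) ∧
      u ∈ Set.univ.pi (fun j => conv (C' j)) ∧ weightedSum t u = y := by
    rintro _ ⟨⟨u, hu, rfl⟩, ⟨u', hu', h⟩⟩
    have : u' = u := (hS.bijOn ht).injOn (Set.mem_iUnion₂.2 ⟨C', hC', hu'⟩)
      (Set.mem_iUnion₂.2 ⟨C, hC, hu⟩) h
    exact ⟨u, hu, this ▸ hu', rfl⟩
  rcases (scaledCell t C ∩ scaledCell t C').eq_empty_or_nonempty with hemp | ⟨y₀, hy₀⟩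
  · rw [AEDisjoint, hemp, measure_empty]
  have hcap : ∀ u ∈ Set.univ.pi (fun j => conv (C j)), u ∈ Set.univ.pi (fun j => conv (C' j)) →
      weightedSum 1 u ∈ cellConv C ∩ cellConv C' := by
    intro u hu hu'
    rw [cellConv_eq, cellConv_eq]
    exact ⟨⟨u, hu, rfl⟩, ⟨u, hu', rfl⟩⟩
  obtain ⟨u₀, hu₀, hu₀', -⟩ := hmem y₀ hy₀
  obtain ⟨D, ⟨γ, hγ⟩, ⟨γ', hγ'⟩, hD⟩ := hS.inter C hC C' hC' ⟨_, hcap u₀ hu₀ hu₀'⟩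
  -- one of the two covectors is not zero
  obtain ⟨C₁, hC₁, γ₁, hγ₁, hγ₁0, hsub⟩ : ∃ C₁ ∈ S, ∃ γ₁, D = face C₁ γ₁ ∧ γ₁ ≠ 0 ∧
      ∀ u ∈ Set.univ.pi (fun j => conv (C j)), u ∈ Set.univ.pi (fun j => conv (C' j)) →
        u ∈ Set.univ.pi (fun j => conv (C₁ j)) := by
    by_cases h : γ = 0
    · refine ⟨C', hC', γ', hγ', ?_, fun u _ hu' => hu'⟩
      rintro rfl
      rw [h, face_zero] at hγ
      rw [face_zero] at hγ'
      exact hne (hγ.symm.trans hγ')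
    · exact ⟨C, hC, γ, hγ, h, fun u hu _ => hu⟩
  choose r hr using exists_eq_on_conv_face C₁ γ₁
  have hlevel : ∀ y ∈ scaledCell t C ∩ scaledCell t C', γ₁ y = ∑ j, t j * r j := by
    intro y hy
    obtain ⟨u, hu, hu', rfl⟩ := hmem y hy
    have hxD : weightedSum 1 u ∈ cellConv D := hD ▸ hcap u hu hu'
    rw [cellConv_eq, hγ₁] at hxD
    obtain ⟨v, hv, hvu⟩ := hxD
    have h1 : v = u := weightedSum_injOn (hS.ker_eq_bot hC₁) (fun _ => one_ne_zero)
      (fun j hj => conv_mono (face_subset C₁ γ₁ j) (hv j hj)) (hsub u hu hu') hvu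
    subst h1
    simp only [weightedSum_apply, map_sum, map_smul, smul_eq_mul]
    exact Finset.sum_congr rfl fun j _ => by rw [hr j _ (hv j trivial)]
  refine measure_mono_null (t := (AffineSubspace.mk' y₀ (LinearMap.ker γ₁) : Set (Fin d → ℝ)))
    (fun y hy => ?_) (Measure.addHaar_affineSubspace volume _ fun htop => hγ₁0 ?_)
  · rw [SetLike.mem_coe, AffineSubspace.mem_mk', vsub_eq_sub, LinearMap.mem_ker, map_sub,
      hlevel y hy, hlevel y₀ hy₀, sub_self]
  · have := congrArg AffineSubspace.direction htop
    rw [AffineSubspace.direction_mk', AffineSubspace.direction_top] at this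
    exact LinearMap.ker_eq_top.1 this

/-- Integrals over the rescaled Minkowski sum are computed cell by cell. -/
theorem IsMixedSubdivision.integral_scaledCell (hS : IsMixedSubdivision B S)
    {t : Fin (k + 1) → ℝ} (ht : ∀ j, 0 < t j) {F : Type*} [NormedAddCommGroup F] [NormedSpace ℝ F]
    {f : (Fin d → ℝ) → F} (hf : Continuous f) :
    ∫ x in scaledCell t B, f x = ∑ C ∈ S, ∫ x in scaledCell t C, f x := by
  have hU : ⋃ C : S, scaledCell t C.1 = scaledCell t B := by
    rw [← hS.biUnion_scaledCell ht, Set.iUnion_subtype]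
  rw [← hU, integral_iUnion_ae, tsum_fintype, Finset.sum_coe_sort S
    (fun C => ∫ x in scaledCell t C, f x)]
  · exact fun C => (isCompact_scaledCell t C.1).measurableSet.nullMeasurableSet
  · exact fun C C' h => hS.aedisjoint_scaledCell ht C.2 C'.2 fun h' => h (Subtype.ext h')
  · rw [hU]
    exact hf.continuousOn.integrableOn_compact (isCompact_scaledCell t B)

/-! ### Integrals of affine functions over the rescaled subdivision -/

section Integrals

variable {k : ℕ} {B : Config k k} {S : Finset (Config k k)} {F : Type*} [NormedAddCommGroup F]
  [NormedSpace ℝ F]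

/-- The contribution of one full-dimensional cell. -/
theorem IsMixedSubdivision.exists_integral_scaledCell_eq [CompleteSpace F]
    (hS : IsMixedSubdivision B S)
    (hdim : configDim B = k) (L : (Fin k → ℝ) →ₗ[ℝ] F) (b : Fin (k + 1) → F) {C : Config k k}
    (hC : C ∈ S) : ∃ w : Fin (k + 1) → F,
      (∀ t : Fin (k + 1) → ℝ, (∀ j, 0 < t j) →
        ∫ x in scaledCell t C, (L x + ∑ j, t j • b j) =
          ∑ j, ((∏ i, t i ^ cellType C i) * t j) • w j) ∧
      ∀ i c, C i = {c} → w i = cellVol C • (L (toReal c) + b i) := by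
  obtain ⟨X, hXc, hX, hint⟩ := exists_summands_integral_eq (F := F) volume
    (fun j => isCompact_conv (C j)) (fun j => conv_nonempty (hS.isCell C hC j).1)
    (hS.ker_eq_bot hC) (by
      have h := hS.mixed C hC
      simp only [dim_eq] at h
      rw [h, hdim, Module.finrank_fin_fun])
  have hL : Continuous L := L.continuous_of_finiteDimensional
  have hi : ∀ j, IntegrableOn (fun x => L (X x j) + b j) (scaledCell 1 C) := fun j =>
    (((hL.comp ((continuous_apply j).comp hXc)).add continuous_const).continuousOn
      ).integrableOn_compact (isCompact_scaledCell 1 C)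
  refine ⟨fun j => ∫ x in scaledCell 1 C, (L (X x j) + b j), fun t ht => ?_, fun i c hc => ?_⟩
  · have h1 : ∀ x, L (weightedSum t (X x)) + ∑ j, t j • b j =
        ∑ j, t j • (L (X x j) + b j) := by
      intro x
      simp [smul_add, Finset.sum_add_distrib]
    rw [scaledCell, hint t ht, ← scaledCell]
    simp only [h1]
    rw [integral_finsetSum (f := fun j x => t j • (L (X x j) + b j)) _
      fun j _ => (hi j).smul (t j), Finset.smul_sum]
    refine Finset.sum_congr rfl fun j _ => ?_
    rw [integral_smul, smul_smul]
    simp only [cellType, dim_eq]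
  · have h1 : ∀ x ∈ scaledCell 1 C, L (X x i) + b i = L (toReal c) + b i := by
      rintro _ ⟨u, hu, rfl⟩
      have h2 := hu i trivial
      simp only [hc, conv, realPts, Finset.coe_singleton, Set.image_singleton,
        convexHull_singleton, Set.mem_singleton_iff] at h2
      rw [hX u hu, h2]
    simp only
    rw [setIntegral_congr_fun (isCompact_scaledCell 1 C).measurableSet h1, setIntegral_const,
      cellVol, cellConv_eq]
    rfl

/-- The integral over `∑ t j • conv (B j)` of an affine function whose constant term is linear in
`t` is a homogeneous polynomial of degree `k + 1` in `t`, with one block of terms for each cell. -/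
theorem IsMixedSubdivision.exists_integral_eq [CompleteSpace F] (hS : IsMixedSubdivision B S)
    (L : (Fin k → ℝ) →ₗ[ℝ] F) (b : Fin (k + 1) → F) :
    ∃ w : Config k k → Fin (k + 1) → F,
      (∀ t : Fin (k + 1) → ℝ, (∀ j, 0 < t j) →
        ∫ x in scaledCell t B, (L x + ∑ j, t j • b j) =
          ∑ C ∈ S, ∑ j, ((∏ i, t i ^ cellType C i) * t j) • w C j) ∧
      (∀ C ∈ S, ∀ j, w C j ≠ 0 → ∑ i, cellType C i = k) ∧
      ∀ C ∈ S, ∀ i, cellType C = eps i → ∀ c, C i = {c} →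
        w C i = cellVol C • (L (toReal c) + b i) := by
  have hf : ∀ t : Fin (k + 1) → ℝ, Continuous fun x => L x + ∑ j, t j • b j := fun t =>
    L.continuous_of_finiteDimensional.add continuous_const
  by_cases hdim : configDim B = k
  · have h : ∀ C : Config k k, ∃ w : Fin (k + 1) → F, C ∈ S →
        (∀ t : Fin (k + 1) → ℝ, (∀ j, 0 < t j) →
        ∫ x in scaledCell t C, (L x + ∑ j, t j • b j) =
          ∑ j, ((∏ i, t i ^ cellType C i) * t j) • w j) ∧
        ∀ i c, C i = {c} → w i = cellVol C • (L (toReal c) + b i) := by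
      intro C
      by_cases hC : C ∈ S
      · obtain ⟨w, hw⟩ := hS.exists_integral_scaledCell_eq hdim L b hC
        exact ⟨w, fun _ => hw⟩
      · exact ⟨0, fun h => absurd h hC⟩
    choose w hw using h
    refine ⟨w, fun t ht => ?_, fun C hC _ _ => (hS.mixed C hC).trans hdim,
      fun C hC i _ c hc => (hw C hC).2 i c hc⟩
    rw [hS.integral_scaledCell ht (hf t)]
    exact Finset.sum_congr rfl fun C hC => (hw C hC).1 t ht
  · -- all cells are null sets, and no cell has type `eps i`
    have hlt : configDim B < k := by
      refine lt_of_le_of_ne ?_ hdim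
      exact (Submodule.finrank_le _).trans_eq (Module.finrank_fin_fun ℝ)
    refine ⟨0, fun t ht => ?_, fun C _ j h => absurd rfl h, fun C hC i hi => ?_⟩
    · rw [hS.integral_scaledCell ht (hf t)]
      simp only [Pi.zero_apply, smul_zero, Finset.sum_const_zero]
      refine Finset.sum_eq_zero fun C hC => setIntegral_measure_zero _ ?_
      refine addHaar_image_weightedSum_eq_zero volume t ?_
      have h := hS.mixed C hC
      simp only [dim_eq] at h
      rwa [h, Module.finrank_fin_fun]
    · have h : ∑ j, cellType C j = configDim B := hS.mixed C hC
      rw [hi] at h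
      have h' : ∑ j, eps i j = k := by
        simp [eps, Finset.sum_ite, Finset.filter_ne']
      exact absurd (h.symm.trans h') hdim

end Integrals

/-! ### Comparing coefficients -/

section Coefficients

/-- Polynomials with vector coefficients that agree on the positive orthant have the same
coefficients. -/
theorem eq_of_sum_prod_pow_smul_eq {σ : Type*} [Fintype σ] {m : ℕ} (T : Finset (σ → ℕ))
    {g g' : (σ → ℕ) → Fin m → ℝ}
    (h : ∀ t : σ → ℝ, (∀ i, 0 < t i) →
      ∑ e ∈ T, (∏ i, t i ^ e i) • g e = ∑ e ∈ T, (∏ i, t i ^ e i) • g' e)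
    {e : σ → ℕ} (he : e ∈ T) : g e = g' e := by
  classical
  ext l
  let poly : ((σ → ℕ) → Fin m → ℝ) → MvPolynomial σ ℝ := fun g =>
    ∑ e ∈ T, MvPolynomial.monomial (Finsupp.equivFunOnFinite.symm e) (g e l)
  have heval : ∀ g t, MvPolynomial.eval t (poly g) = (∑ e ∈ T, (∏ i, t i ^ e i) • g e) l := by
    intro g t
    simp only [poly, map_sum, MvPolynomial.eval_monomial, Finset.sum_apply, Pi.smul_apply,
      smul_eq_mul]
    refine Finset.sum_congr rfl fun e _ => ?_
    rw [mul_comm, Finsupp.prod_fintype _ _ (by simp)]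
    simp
  have hcoeff : ∀ g, MvPolynomial.coeff (Finsupp.equivFunOnFinite.symm e) (poly g) = g e l := by
    intro g
    simp only [poly, MvPolynomial.coeff_sum, MvPolynomial.coeff_monomial]
    rw [Finset.sum_eq_single e]
    · simp
    · intro e' _ hne
      rw [if_neg (fun h => hne (Finsupp.equivFunOnFinite.symm.injective h))]
    · exact fun h => absurd he h
  have hpoly : poly g = poly g' := by
    refine MvPolynomial.funext_set (fun _ => Set.Ioi (0 : ℝ)) (fun _ => Set.Ioi_infinite 0)
      fun t ht => ?_
    rw [heval, heval, h t fun i => ht i trivial]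
  rw [← hcoeff g, hpoly, hcoeff]

end Coefficients

end MixedFiber

/-! ### Convex sets on which a linear map is injective -/

section ConvexInj

variable {E F : Type*} [AddCommGroup E] [Module ℝ E] [AddCommGroup F] [Module ℝ F]

theorem Convex.exists_eq_smul_sub_of_mem_vectorSpan {s : Set E} (hs : Convex ℝ s)
    (hne : s.Nonempty) {v : E} (hv : v ∈ vectorSpan ℝ s) :
    ∃ r : ℝ, 0 ≤ r ∧ ∃ x ∈ s, ∃ y ∈ s, v = r • (x - y) := by
  obtain ⟨z, hz⟩ := hne
  rw [vectorSpan_def] at hv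
  induction hv using Submodule.span_induction with
  | mem v hv =>
    obtain ⟨x, hx, y, hy, rfl⟩ := hv
    exact ⟨1, zero_le_one, x, hx, y, hy, by simp⟩
  | zero => exact ⟨0, le_rfl, z, hz, z, hz, by simp⟩
  | add v v' _ _ ih ih' =>
    obtain ⟨r, hr, x, hx, y, hy, rfl⟩ := ih
    obtain ⟨r', hr', x', hx', y', hy', rfl⟩ := ih'
    rcases (add_nonneg hr hr').eq_or_lt with h | h
    · obtain rfl : r = 0 := by linarith
      obtain rfl : r' = 0 := by linarith
      exact ⟨0, le_rfl, z, hz, z, hz, by simp⟩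
    · have h1 : r / (r + r') + r' / (r + r') = 1 := by field_simp
      refine ⟨r + r', h.le, (r / (r + r')) • x + (r' / (r + r')) • x',
        hs hx hx' (by positivity) (by positivity) h1,
        (r / (r + r')) • y + (r' / (r + r')) • y',
        hs hy hy' (by positivity) (by positivity) h1, ?_⟩
      simp only [smul_sub, smul_add, smul_smul, mul_div_cancel₀ _ h.ne']
      abel
  | smul a v _ ih =>
    obtain ⟨r, hr, x, hx, y, hy, rfl⟩ := ih
    rcases le_total 0 a with h | h
    · exact ⟨a * r, mul_nonneg h hr, x, hx, y, hy, by rw [smul_smul]⟩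
    · exact ⟨-a * r, mul_nonneg (neg_nonneg.2 h) hr, y, hy, x, hx, by module⟩

theorem Convex.eq_zero_of_injOn {s : Set E} (hs : Convex ℝ s) (hne : s.Nonempty) {f : E →ₗ[ℝ] F}
    (hf : Set.InjOn f s) {v : E} (hv : v ∈ vectorSpan ℝ s) (h0 : f v = 0) : v = 0 := by
  obtain ⟨r, -, x, hx, y, hy, rfl⟩ := hs.exists_eq_smul_sub_of_mem_vectorSpan hne hv
  rw [map_smul, smul_eq_zero, map_sub, sub_eq_zero] at h0
  rcases h0 with rfl | h
  · simp
  · simp [hf hx hy h]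

/-- Over a convex set on which `f` is injective, every linear map is a linear function of `f`, up
to a constant. -/
theorem Convex.exists_linearMap_of_injOn {G : Type*} [AddCommGroup G] [Module ℝ G] {s : Set E}
    (hs : Convex ℝ s) (hne : s.Nonempty) {f : E →ₗ[ℝ] F} (hf : Set.InjOn f s) (g : E →ₗ[ℝ] G) :
    ∃ L : F →ₗ[ℝ] G, ∀ v ∈ vectorSpan ℝ s, g v = L (f v) := by
  obtain ⟨h, hh⟩ := (f.domRestrict (vectorSpan ℝ s)).exists_leftInverse_of_injective (by
    rw [LinearMap.ker_eq_bot']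
    rintro ⟨v, hv⟩ h0
    exact Subtype.ext (hs.eq_zero_of_injOn hne hf hv h0))
  refine ⟨g ∘ₗ (vectorSpan ℝ s).subtype ∘ₗ h, fun v hv => ?_⟩
  have := LinearMap.congr_fun hh ⟨v, hv⟩
  simp only [LinearMap.comp_apply, LinearMap.domRestrict_apply, LinearMap.id_apply] at this
  simp [this]

end ConvexInj

namespace MixedFiber

/-! ### Fiber polytopes of injectively projected sums -/

section Fiber

variable {m k : ℕ}

/-- If `p` is injective on `∑ conv (A i)`, then `π` is an affine function of `p` on each summand,
with the same linear part for all of them. -/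
theorem exists_projFst_eq (A : Config k (m + k)) (hA : ∀ i, (A i).Nonempty)
    (hp : Set.InjOn (projLast ℝ m k) (∑ i, conv (A i))) :
    ∃ (L : (Fin k → ℝ) →ₗ[ℝ] (Fin m → ℝ)) (b : Fin (k + 1) → Fin m → ℝ),
      ∀ i, ∀ x ∈ conv (A i), projFst ℝ m k x = L (projLast ℝ m k x) + b i := by
  rw [sum_eq_image_weightedSum_one] at hp
  have hconv : Convex ℝ (weightedSum 1 '' Set.univ.pi fun i => conv (A i)) :=
    (convex_pi fun i _ => convex_conv (A i)).linear_image
      (weightedSum (1 : Fin (k + 1) → ℝ)).toLinearMap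
  choose z hz using fun i => conv_nonempty (hA i)
  obtain ⟨L, hL⟩ := hconv.exists_linearMap_of_injOn ⟨_, z, fun i _ => hz i, rfl⟩ hp
    (projFst ℝ m k)
  refine ⟨L, fun i => projFst ℝ m k (z i) - L (projLast ℝ m k (z i)), fun i x hx => ?_⟩
  have hv : x - z i ∈ vectorSpan ℝ (weightedSum 1 '' Set.univ.pi fun i => conv (A i)) := by
    have h1 : x - z i = weightedSum 1 (Function.update z i x) - weightedSum 1 z := by
      rw [← map_sub, weightedSum_apply, Finset.sum_eq_single i]
      · simp
      · intro j _ hj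
        simp [hj]
      · simp
    rw [h1]
    refine vsub_mem_vectorSpan ℝ ⟨_, fun j _ => ?_, rfl⟩ ⟨z, fun j _ => hz j, rfl⟩
    rcases eq_or_ne j i with rfl | hj
    · simpa using hx
    · simpa [hj] using hz j
  have h2 := hL _ hv
  simp only [map_sub] at h2
  rw [sub_eq_iff_eq_add.1 h2, sub_add_eq_add_sub, add_sub_assoc]

theorem projLast_toReal (a : Fin (m + k) → ℤ) :
    projLast ℝ m k (toReal a) = toReal (projLast ℤ m k a) := rfl

theorem projLast_image_conv (A : Config k (m + k)) (i : Fin (k + 1)) :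
    projLast ℝ m k '' conv (A i) = conv (projConfig A i) := by
  classical
  rw [conv, LinearMap.image_convexHull, conv, realPts, realPts, Set.image_image, projConfig,
    Finset.coe_image, Set.image_image]
  rfl

theorem projLast_image_sum (A : Config k (m + k)) (t : Fin (k + 1) → ℝ) :
    projLast ℝ m k '' ∑ i, t i • conv (A i) = scaledCell t (projConfig A) := by
  rw [Set.image_finsetSum, scaledCell, ← sum_smul_eq_image_weightedSum]
  exact Finset.sum_congr rfl fun i _ => by rw [image_smul_set, projLast_image_conv]

theorem append_proj (z : Fin (m + k) → ℝ) :
    Fin.append (projFst ℝ m k z) (projLast ℝ m k z) = z := by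
  ext j
  refine Fin.addCases (fun j => ?_) (fun j => ?_) j
  · simp [projFst, LinearMap.funLeft_apply]
  · simp [projLast, LinearMap.funLeft_apply]

/-- If `π` is an affine function of `p` on each summand, the only section over the weighted
Minkowski sum is the affine one. -/
theorem fiberPolytope_sum_eq (A : Config k (m + k)) {L : (Fin k → ℝ) →ₗ[ℝ] (Fin m → ℝ)}
    {b : Fin (k + 1) → Fin m → ℝ}
    (hL : ∀ i, ∀ x ∈ conv (A i), projFst ℝ m k x = L (projLast ℝ m k x) + b i)
    (t : Fin (k + 1) → ℝ) :
    fiberPolytope (∑ i, t i • conv (A i)) =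
      {∫ x in scaledCell t (projConfig A), (L x + ∑ i, t i • b i)} := by
  set D := ∑ i, t i • conv (A i) with hD
  have hLD : ∀ z ∈ D, projFst ℝ m k z = L (projLast ℝ m k z) + ∑ i, t i • b i := by
    intro z hz
    rw [hD, sum_smul_eq_image_weightedSum] at hz
    obtain ⟨u, hu, rfl⟩ := hz
    simp only [weightedSum_apply, map_sum, map_smul]
    rw [← Finset.sum_add_distrib]
    exact Finset.sum_congr rfl fun i _ => by rw [hL i _ (hu i trivial), smul_add]
  have hcompact := isCompact_scaledCell t (projConfig A)
  have hLc : Continuous L := L.continuous_of_finiteDimensional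
  have hint : ∀ s, IsSection D s → projFst ℝ m k (∫ x in projLast ℝ m k '' D, s x) =
      ∫ x in scaledCell t (projConfig A), (L x + ∑ i, t i • b i) := by
    intro s hs
    have hs1 := hs.1
    have hs2 := hs.2
    rw [projLast_image_sum] at hs1 hs2 ⊢
    have h1 := (LinearMap.toContinuousLinearMap (projFst ℝ m k)).integral_comp_comm
      (hs1.integrableOn_compact (μ := volume) hcompact)
    rw [← LinearMap.coe_toContinuousLinearMap' (projFst ℝ m k), ← h1]
    refine setIntegral_congr_fun hcompact.measurableSet fun x hx => ?_
    obtain ⟨h2, h3⟩ := hs2 x hx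
    simp only [LinearMap.coe_toContinuousLinearMap', hLD _ h2, h3]
  have hsec : IsSection D fun x => Fin.append (L x + ∑ i, t i • b i) x := by
    refine ⟨Continuous.continuousOn ?_, ?_⟩
    · refine continuous_pi fun j => ?_
      refine Fin.addCases (fun j => ?_) (fun j => ?_) j
      · simp only [Fin.append_left]
        exact (continuous_apply j).comp (hLc.add continuous_const)
      · simp only [Fin.append_right]
        exact continuous_apply j
    · rintro _ ⟨z, hz, rfl⟩
      beta_reduce
      rw [← hLD z hz, append_proj]
      exact ⟨hz, rfl⟩
  refine Set.eq_singleton_iff_unique_mem.2 ⟨⟨_, ⟨_, hsec, rfl⟩, hint _ hsec⟩, ?_⟩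
  rintro _ ⟨_, ⟨s, hs, rfl⟩, rfl⟩
  exact hint s hs

theorem eq_singleton_of_dim_conv_eq_zero {d : ℕ} {s : Finset (Fin d → ℤ)} (hs : s.Nonempty)
    (h : dim (conv s) = 0) : ∃ c, s = {c} := by
  obtain ⟨c, hc⟩ := hs
  refine ⟨c, Finset.eq_singleton_iff_unique_mem.2 ⟨hc, fun a ha => ?_⟩⟩
  rw [dim_eq, Submodule.finrank_eq_zero] at h
  have hmem : ∀ a ∈ s, toReal a ∈ conv s := fun a ha =>
    subset_convexHull ℝ _ ⟨a, ha, rfl⟩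
  have h1 := vsub_mem_vectorSpan ℝ (hmem a ha) (hmem c hc)
  rw [h, Submodule.mem_bot, vsub_eq_sub, sub_eq_zero] at h1
  ext j
  have := congrFun h1 j
  simpa [toReal] using this

/-- If `C i` is a single point `c`, the points of `A i` over `c` all have the same image under `π`. -/
theorem fiberImage_eq (A : Config k (m + k)) {L : (Fin k → ℝ) →ₗ[ℝ] (Fin m → ℝ)}
    {b : Fin (k + 1) → Fin m → ℝ}
    (hL : ∀ i, ∀ x ∈ conv (A i), projFst ℝ m k x = L (projLast ℝ m k x) + b i)
    {C : Config k k} {i : Fin (k + 1)} (hCA : C i ⊆ projConfig A i) {c : Fin k → ℤ}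
    (hc : C i = {c}) : fiberImage A C i = {L (toReal c) + b i} := by
  classical
  have hval : ∀ a ∈ A i, projLast ℤ m k a ∈ C i →
      projFst ℝ m k (toReal a) = L (toReal c) + b i := by
    intro a ha hac
    rw [hc, Finset.mem_singleton] at hac
    rw [hL i _ (subset_convexHull ℝ _ ⟨a, ha, rfl⟩), projLast_toReal, hac]
  obtain ⟨a, ha, hac⟩ := Finset.mem_image.1 (hCA (hc ▸ Finset.mem_singleton_self c))
  have hac' : projLast ℤ m k a ∈ C i := by rw [hac, hc]; exact Finset.mem_singleton_self c
  refine Set.eq_singleton_iff_unique_mem.2 ⟨⟨_, ⟨a, ⟨ha, hac'⟩, rfl⟩, hval a ha hac'⟩, ?_⟩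
  rintro _ ⟨_, ⟨a, ⟨ha, hac⟩, rfl⟩, rfl⟩
  exact hval a ha hac

end Fiber

/-! ### The mixed fiber polytope -/

section Main

variable {m k : ℕ}

theorem add_single_eq_one_iff (e : Fin (k + 1) → ℕ) (i : Fin (k + 1)) :
    e + Pi.single i 1 = (fun _ => 1) ↔ e = eps i := by
  simp only [funext_iff]
  refine forall_congr' fun j => ?_
  rcases eq_or_ne j i with rfl | h
  · simp [eps]
  · simp [eps, h]

/-- The mixed cells contribute the coefficient of `t₀ ⋯ tₖ`: the block of the cell `C` in the
polynomial of `IsMixedSubdivision.exists_integral_eq` meets that monomial only if the type of `C`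
is some `eps i`. -/
theorem exists_coefficients (A : Config k (m + k)) (hA : ∀ i, (A i).Nonempty)
    (hp : Set.InjOn (projLast ℝ m k) (∑ i, conv (A i))) {S : Finset (Config k k)}
    (hS : IsMixedSubdivision (projConfig A) S) :
    ∃ W : (Fin (k + 1) → ℕ) → Fin m → ℝ,
      (∀ t : Fin (k + 1) → ℝ, (∀ i, 0 < t i) → fiberPolytope (∑ i, t i • conv (A i)) =
        {∑ e ∈ Finset.piAntidiag (Finset.univ : Finset (Fin (k + 1))) (k + 1),
          (∏ i, t i ^ e i) • W e}) ∧
      mixedCellSum A S = {W fun _ => 1} := by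
  classical
  obtain ⟨L, b, hL⟩ := exists_projFst_eq A hA hp
  obtain ⟨w, hw, hw0, hw1⟩ := hS.exists_integral_eq L b
  refine ⟨fun e => ∑ C ∈ S, ∑ j, if cellType C + Pi.single j 1 = e then w C j else 0,
    fun t ht => ?_, ?_⟩
  · rw [fiberPolytope_sum_eq A hL, hw t ht, Set.singleton_eq_singleton_iff]
    simp only [Finset.smul_sum]
    symm
    rw [Finset.sum_comm]
    refine Finset.sum_congr rfl fun C hC => ?_
    rw [Finset.sum_comm]
    refine Finset.sum_congr rfl fun j _ => ?_
    simp only [smul_ite, smul_zero, Finset.sum_ite_eq]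
    by_cases h : w C j = 0
    · simp [h]
    · have hmem : cellType C + Pi.single j 1 ∈
          Finset.piAntidiag (Finset.univ : Finset (Fin (k + 1))) (k + 1) := by
        simp [Finset.sum_add_distrib, hw0 C hC j h]
      have hprod : ∏ i, t i ^ (cellType C + Pi.single j 1 : Fin (k + 1) → ℕ) i =
          (∏ i, t i ^ cellType C i) * t j := by
        simp only [Pi.add_apply, pow_add, Finset.prod_mul_distrib]
        congr 1
        rw [Finset.prod_eq_single j]
        · simp
        · intro i _ hij
          simp [hij]
        · simp
      rw [if_pos hmem, hprod]
  · have h1 : mixedCellSum A S =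
        ∑ i, ∑ C ∈ S.filter (fun C => cellType C = eps i), ({w C i} : Set (Fin m → ℝ)) := by
      refine Finset.sum_congr rfl fun i _ => Finset.sum_congr (by congr) fun C hC => ?_
      obtain ⟨hCS, hCi⟩ := Finset.mem_filter.1 hC
      have hdim : dim (conv (C i)) = 0 := by
        have := congrFun hCi i
        simpa [cellType, eps] using this
      obtain ⟨c, hc⟩ := eq_singleton_of_dim_conv_eq_zero (hS.isCell C hCS i).1 hdim
      rw [fiberImage_eq A hL (hS.isCell C hCS i).2 hc, hw1 C hCS i hCi c hc,
        Set.smul_set_singleton]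
    rw [h1]
    simp only [Set.finsetSum_singleton, add_single_eq_one_iff]
    rw [Finset.sum_comm, Set.singleton_eq_singleton_iff]
    exact Finset.sum_congr rfl fun i _ => Finset.sum_filter _ _

theorem isPolytope_singleton {d : ℕ} (v : Fin d → ℝ) : IsPolytope {v} :=
  ⟨{v}, by simp⟩

/-- If the fiber polytopes of `∑ t i • Δ i` are points that depend polynomially on `t`, the mixed
fiber polytope is the coefficient of that polynomial. -/
theorem isMixedFiberPolytope_iff {Δ : Fin (k + 1) → Set (Fin (m + k) → ℝ)}
    {W : (Fin (k + 1) → ℕ) → Fin m → ℝ}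
    (hW : ∀ t : Fin (k + 1) → ℝ, (∀ i, 0 < t i) → fiberPolytope (∑ i, t i • Δ i) =
      {∑ e ∈ Finset.piAntidiag (Finset.univ : Finset (Fin (k + 1))) (k + 1),
        (∏ i, t i ^ e i) • W e}) (M : Set (Fin m → ℝ)) :
    IsMixedFiberPolytope Δ M ↔ M = {W fun _ => 1} := by
  classical
  constructor
  · rintro ⟨c, -, hc, rfl⟩
    set T := Finset.piAntidiag (Finset.univ : Finset (Fin (k + 1))) (k + 1)
    have h1T : (fun _ => 1) ∈ T := by simp [T]
    have hsum : ∀ t : Fin (k + 1) → ℝ, (∀ i, 0 < t i) →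
        ∑ e ∈ T, (∏ i, t i ^ e i) • c e = {∑ e ∈ T, (∏ i, t i ^ e i) • W e} :=
      fun t ht => (hc t ht).symm.trans (hW t ht)
    -- any choice of points in the coefficients satisfies the same polynomial identity
    have hchoice : ∀ g : (Fin (k + 1) → ℕ) → Fin m → ℝ, (∀ e ∈ T, g e ∈ c e) →
        g (fun _ => 1) = W fun _ => 1 := by
      intro g hg
      refine eq_of_sum_prod_pow_smul_eq T (fun t ht => ?_) h1T
      rw [← Set.mem_singleton_iff, ← hsum t ht]
      exact Set.finsetSum_mem_finsetSum _ _ _ fun e he => Set.smul_mem_smul_set (hg e he)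
    obtain ⟨g, hg⟩ : ∃ g : (Fin (k + 1) → ℕ) → Fin m → ℝ, ∀ e ∈ T, g e ∈ c e := by
      have h := hsum 1 fun _ => one_pos
      simp only [Pi.one_apply, one_pow, Finset.prod_const_one, one_smul] at h
      obtain ⟨g, hg, -⟩ := (Set.mem_finsetSum _ _ _).1 (h ▸ Set.mem_singleton _)
      exact ⟨g, fun e he => hg he⟩
    refine Set.eq_singleton_iff_unique_mem.2 ⟨hchoice g hg ▸ hg _ h1T, fun a ha => ?_⟩
    have := hchoice (Function.update g (fun _ => 1) a) fun e he => ?_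
    · simpa using this
    · rcases eq_or_ne e fun _ => 1 with rfl | h
      · simpa using ha
      · simpa [h] using hg e he
  · rintro rfl
    refine ⟨fun e => {W e}, fun e => isPolytope_singleton _, fun t ht => ?_, rfl⟩
    simp only [hW t ht, Set.smul_set_singleton, Set.finsetSum_singleton]

end Main

end MixedFiber

theorem lemma3p1 (m k : ℕ) (A : MixedFiber.Config k (m + k)) (hA : ∀ i, (A i).Nonempty)
    (hp : Set.BijOn (MixedFiber.projLast ℝ m k) (∑ i, MixedFiber.conv (A i))
      (MixedFiber.projLast ℝ m k '' ∑ i, MixedFiber.conv (A i)))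
    (S : Finset (MixedFiber.Config k k))
    (hS : MixedFiber.IsMixedSubdivision (MixedFiber.projConfig A) S) :
    (∃ v : Fin m → ℝ, MixedFiber.mixedCellSum A S = {v}) ∧
      ∀ M : Set (Fin m → ℝ),
        MixedFiber.IsMixedFiberPolytope (fun i => MixedFiber.conv (A i)) M ↔
          M = MixedFiber.mixedCellSum A S := by
  obtain ⟨W, hW, hS1⟩ := MixedFiber.exists_coefficients A hA hp.injOn hS
  refine ⟨⟨_, hS1⟩, fun M => ?_⟩
  rw [hS1]
  exact MixedFiber.isMixedFiberPolytope_iff hW M
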